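/- **Proposition 3.17.** Let $E$ be a (real) Banach lattice, $Y$ a (real) Banach space and $T:E\to Y$ a bounded linear operator. For $S\subset E$ put $\mathrm{sol}(S)=\{x\in E:\ |x|\le |y| \text{ for some } y\in S\}$. A net $(x_\alpha)$ in $E$ is called uaw-null if, for every $u\in E$ with $u\ge 0$, the net $(|x_\alpha|\wedge u)$ converges weakly to $0$. The operator $T$ is called almost Dunford–Pettis if $\|Tx_n\|\to 0$ for every weakly null sequence $(x_n)$ in $E$ that is disjoint (that is, $|x_m|\wedge|x_n|=0$ for $m\ne n$). For a norm bounded set $S\subset E$, the operator $T$ is called $S$-L-weakly compact if $\|Tx_n\|\to0$ for every uaw-null sequence $(x_n)$ in $\mathrm{sol}(S)$. The following statements are equivalent: 1. $T$ is almost Dunford–Pettis. 2. For every relatively weakly compact subset $S$ of $E$, the operator $T$ is $S$-L-weakly compact. 3. For every relatively weakly compact subset $S$ of $E$ and every uaw-null net $(x_\alpha)$ in $\mathrm{sol}(S)$, we have $\|Tx_\alpha\|\to 0$. 4. For every relatively weakly compact subset $S$ of $E$ and every uaw-null sequence $(x_n)$ in $\mathrm{sol}(S)$, we have $\|Tx_n\|\to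 0$. -/

import Mathlib

open Filter Topology

namespace BanachLatticeOps

section Lattice

variable {E : Type*} [NormedAddCommGroup E] [NormedSpace ℝ E] [Lattice E]

/-- The solid hull `sol(A) = {x | ∃ y ∈ A, |x| ≤ |y|}` of a subset of a vector lattice. -/
def sol (A : Set E) : Set E := {x | ∃ y ∈ A, |x| ≤ |y|}

/-- A sequence is disjoint if its terms are pairwise disjoint: `|xₘ| ∧ |xₙ| = 0` for `m ≠ n`. -/
def IsDisjointSeq (x : ℕ → E) : Prop := ∀ m n, m ≠ n → |x m| ⊓ |x n| = 0

/-- Unbounded absolutely weak (uaw) convergence of a family `x` to `a` along a filter `l`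
(for a net, the filter `atTop` of its directed index set):
for every `u ≥ 0` in `E`, `|xᵢ - a| ∧ u` converges to `0` in the weak topology. -/
def UAWTendsto {ι : Type*} (x : ι → E) (l : Filter ι) (a : E) : Prop :=
  ∀ u : E, 0 ≤ u →
    Tendsto (fun i => toWeakSpace ℝ E (|x i - a| ⊓ u)) l (𝓝 (toWeakSpace ℝ E 0))

variable {Y : Type*} [NormedAddCommGroup Y] [NormedSpace ℝ Y]

/-- `T` is almost Dunford-Pettis: it maps disjoint weakly null sequences to norm null ones. -/
def IsAlmostDunfordPettis (T : E →L[ℝ] Y) : Prop :=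
  ∀ x : ℕ → E, IsDisjointSeq x →
    Tendsto (fun n => toWeakSpace ℝ E (x n)) atTop (𝓝 (toWeakSpace ℝ E 0)) →
    Tendsto (fun n => T (x n)) atTop (𝓝 0)

/-- `T` is `S`-L-weakly compact (the notion is meant for norm bounded `S`): it maps
uaw-null sequences of `sol(S)` to norm null ones. -/
def IsLWeaklyCompactOn (S : Set E) (T : E →L[ℝ] Y) : Prop :=
  ∀ x : ℕ → E, (∀ n, x n ∈ sol S) → UAWTendsto x atTop 0 →
    Tendsto (fun n => T (x n)) atTop (𝓝 0)

end Lattice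

/-- `S` is relatively weakly compact: its closure in the weak topology is weakly compact. -/
def IsRelativelyWeaklyCompact {E : Type*} [NormedAddCommGroup E] [NormedSpace ℝ E]
    (S : Set E) : Prop :=
  IsCompact (closure (toWeakSpace ℝ E '' S))

end BanachLatticeOps

open BanachLatticeOps

universe u v w

namespace BanachLatticeOps

/-! The substance is 1 → 3. Replace `‖T x‖` by `p(x) = sup {‖T z‖ : |z| ≤ |x|}` (`solidSeminorm`),
which is monotone in `|x|` and, by Riesz decomposition, subadditive on the positive cone.

Disjoint sequences in `sol S` are weakly null when `S` is relatively weakly compact. If `|xₙ| ≤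
|yₙ|` with `yₙ ∈ S`, the parts of a positive functional carried by the bands of the `xₙ` add up to
at most that functional, so they give a bounded operator into `ℓ¹`; a gliding hump makes its
coordinates uniformly small on `S`. Hence an almost Dunford–Pettis `T` is null on disjoint sequences
of `sol S`, and in particular on order bounded ones.

Nullity on order bounded disjoint sequences makes order bounded increasing sequences `p`-Cauchy. A
limsup construction then shows that `p` tends to zero along weakly null positive families of an
order interval (`not_forall_lt_of_geometric`).

For a uaw-null family this gives `p(|xᵢ| ⊓ u) → 0` for every `u ≥ 0`. If `p(xᵢ)` did not tend to
zero, an almost disjoint sequence could be extracted with `p` bounded below; up to `p`-small errors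
it is a disjoint sequence in `sol S`, a contradiction.

For 2 → 1, disjoint sequences are uaw-null, and a weakly null sequence has relatively weakly compact
range. -/

lemma inf_eq_zero_of_le {G : Type*} [Lattice G] [Zero G] {a b c d : G} (ha : 0 ≤ a) (hb : 0 ≤ b)
    (hac : a ≤ c) (hbd : b ≤ d)
    (h : c ⊓ d = 0) : a ⊓ b = 0 :=
  le_antisymm (h ▸ inf_le_inf hac hbd) (le_inf ha hb)

/-! ### Inequalities in lattice-ordered groups -/

section LatticeGroup

variable {G : Type*} [AddCommGroup G] [Lattice G] [IsOrderedAddMonoid G]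

lemma add_inf_le_inf_add_inf {a b c : G} (ha : 0 ≤ a) (hb : 0 ≤ b) (hc : 0 ≤ c) :
    (a + b) ⊓ c ≤ a ⊓ c + b ⊓ c := by
  rw [← sub_le_iff_le_add', sub_inf]
  refine sup_le (le_inf ?_ ?_) ((sub_nonpos.2 inf_le_right).trans (le_inf hb hc))
  · exact sub_le_iff_le_add'.2 inf_le_left
  · exact (sub_le_self _ ha).trans inf_le_right

/-- Since `a + b = a ⊓ b + a ⊔ b`, a sum of disjoint positive elements is their supremum. -/
lemma sum_le_of_pairwise_disjoint {ι : Type*} {a : ι → G} {y : G} (hy : 0 ≤ y)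
    (ha : ∀ i, 0 ≤ a i) (hay : ∀ i, a i ≤ y) (hd : ∀ i j, i ≠ j → a i ⊓ a j = 0)
    (s : Finset ι) : ∑ i ∈ s, a i ≤ y := by
  classical
  have key : ∀ (s : Finset ι) (i : ι), i ∉ s → (∑ j ∈ s, a j) ⊓ a i = 0 := by
    intro s
    induction s using Finset.induction_on with
    | empty => intro i _; simpa using ha i
    | insert k s hk ih =>
      intro i hi
      rw [Finset.mem_insert, not_or] at hi
      rw [Finset.sum_insert hk]
      refine le_antisymm ?_ (le_inf (add_nonneg (ha k) (Finset.sum_nonneg fun j _ => ha j)) (ha i))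
      refine (add_inf_le_inf_add_inf (ha k) (Finset.sum_nonneg fun j _ => ha j) (ha i)).trans ?_
      rw [hd k i (Ne.symm hi.1), ih i hi.2, add_zero]
  induction s using Finset.induction_on with
  | empty => simpa using hy
  | insert k s hk ih =>
    rw [Finset.sum_insert hk, ← inf_add_sup (a k), inf_comm, key s k hk, zero_add]
    exact sup_le (hay k) ih

/-- The Riesz decomposition property. -/
lemma exists_add_of_abs_le_add {z a b : G} (ha : 0 ≤ a) (hb : 0 ≤ b) (hz : |z| ≤ a + b) :
    ∃ z₁ z₂, z = z₁ + z₂ ∧ |z₁| ≤ a ∧ |z₂| ≤ b := by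
  have h := abs_le'.1 hz
  have hna : -a ≤ a := (neg_nonpos.2 ha).trans ha
  refine ⟨z ⊓ a ⊔ -a, z - (z ⊓ a ⊔ -a), by abel, abs_le'.2 ⟨sup_le inf_le_right hna, ?_⟩,
    abs_le'.2 ⟨?_, ?_⟩⟩
  · exact neg_le.1 le_sup_right
  · rw [sub_sup, sub_inf, sub_self]
    exact inf_le_left.trans (sup_le hb (sub_le_iff_le_add'.2 h.1))
  · rw [neg_le, sub_sup, sub_inf, sub_self]
    refine le_inf ((neg_nonpos.2 hb).trans le_sup_left) ?_
    have := neg_le.1 h.2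
    rw [sub_neg_eq_add]
    calc -b = -(a + b) + a := by abel
      _ ≤ z + a := by gcongr

lemma posPart_inf_posPart_sub_eq_zero (a b : G) : (a - b)⁺ ⊓ (b - a)⁺ = 0 := by
  rw [← neg_sub a b, posPart_neg, posPart_inf_negPart_eq_zero]

lemma posPart_sub_inf_le (y s t : G) : (y - s ⊓ t)⁺ ≤ (y - s)⁺ + (y - t)⁺ := by
  refine sup_le ?_ (add_nonneg (posPart_nonneg _) (posPart_nonneg _))
  rw [sub_inf]
  refine sup_le ((le_posPart _).trans ?_) ((le_posPart _).trans ?_)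
  · exact le_add_of_nonneg_right (posPart_nonneg _)
  · exact le_add_of_nonneg_left (posPart_nonneg _)

lemma le_inf_add_posPart_sub (x u : G) : x ≤ x ⊓ u + (x - u)⁺ := by
  rw [inf_eq_sub_posPart_sub, sub_add_cancel]

end LatticeGroup

/-! ### Layers and disjointification in vector lattices -/

section VectorLattice

variable {E : Type*} [AddCommGroup E] [Module ℝ E] [Lattice E] [IsOrderedAddMonoid E]
  [IsOrderedModule ℝ E]

lemma half_smul_add_le_sup (a b : E) : (1 / 2 : ℝ) • (a + b) ≤ a ⊔ b := by
  calc (1 / 2 : ℝ) • (a + b) ≤ (1 / 2 : ℝ) • (a ⊔ b + a ⊔ b) :=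
        smul_le_smul_of_nonneg_left (add_le_add le_sup_left le_sup_right) (by norm_num)
    _ = a ⊔ b := by rw [← two_smul ℝ, smul_smul]; norm_num

/-- The increment from `a` to `b` is, up to an error `2e`, dominated by the pieces of it that
cross one of the layers between `j • e` and `(j + 1) • e`. -/
lemma half_smul_posPart_le_sum_layers {a b e : E} (he : 0 ≤ e) (ha : 0 ≤ a) (J : ℕ)
    (hb : b ≤ J • e) :
    (1 / 2 : ℝ) • (b - a - 2 • e)⁺ ≤
      ∑ j ∈ Finset.range (J + 1), (b - (j + 1) • e)⁺ ⊓ (j • e - a)⁺ := by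
  let : DistribLattice E := AddCommGroup.toDistribLattice E
  set c : ℕ → E := fun j => (b - (j + 1) • e)⁺ with hc
  set f : ℕ → E := fun j => (j • e - a)⁺ with hf
  set d : E := (1 / 2 : ℝ) • (b - a - 2 • e)⁺ with hd
  have hc0 : ∀ j, 0 ≤ c j := fun j => posPart_nonneg _
  have hf0 : ∀ j, 0 ≤ f j := fun j => posPart_nonneg _
  have half_le : ∀ x : E, 0 ≤ x → (1 / 2 : ℝ) • x ≤ x := fun x hx => by
    simpa using half_smul_add_le_sup x 0 |>.trans_eq (sup_eq_left.2 hx)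
  have hd0 : d ≤ c 0 := by
    refine (half_le _ (posPart_nonneg _)).trans (posPart_mono ?_)
    have : b - (0 + 1) • e - (b - a - 2 • e) = a + e := by
      rw [zero_add, one_smul, two_smul]; abel
    exact sub_nonneg.1 (this ▸ add_nonneg ha he)
  have hstep : ∀ j, d ≤ c (j + 1) ⊔ f j := by
    intro j
    refine le_trans ?_ (half_smul_add_le_sup _ _)
    refine smul_le_smul_of_nonneg_left ?_ (by norm_num)
    refine sup_le ?_ (add_nonneg (hc0 _) (hf0 _))
    have : b - a - 2 • e = (b - (j + 1 + 1) • e) + (j • e - a) := by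
      simp only [add_smul, one_smul, two_smul]; abel
    rw [this]
    exact add_le_add (le_posPart _) (le_posPart _)
  -- By distributivity, what lies below `c k` either meets `f k`, crossing layer `k`, or passes on
  -- to `c (k + 1)`. At `k = J + 1` nothing is left to pass on.
  have key : ∀ k, d ≤ (∑ j ∈ Finset.range k, c j ⊓ f j) ⊔ c k := by
    intro k
    induction k with
    | zero => exact hd0.trans le_sup_right
    | succ k ih =>
      set S := ∑ j ∈ Finset.range k, c j ⊓ f j with hS
      have hSS : S ⊔ (c k ⊓ f k) ≤ ∑ j ∈ Finset.range (k + 1), c j ⊓ f j := by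
        rw [Finset.sum_range_succ]
        exact sup_le (le_add_of_nonneg_right (le_inf (hc0 _) (hf0 _)))
          (le_add_of_nonneg_left (Finset.sum_nonneg fun j _ => le_inf (hc0 _) (hf0 _)))
      calc d ≤ (S ⊔ c k) ⊓ (c (k + 1) ⊔ f k) := le_inf ih (hstep k)
        _ = S ⊓ (c (k + 1) ⊔ f k) ⊔ (c k ⊓ c (k + 1) ⊔ c k ⊓ f k) := by
          rw [inf_sup_right, inf_sup_left (c k)]
        _ ≤ _ := by
          refine sup_le (inf_le_left.trans (le_sup_left.trans (hSS.trans le_sup_left))) ?_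
          exact sup_le (inf_le_right.trans le_sup_right)
            (le_sup_right.trans (hSS.trans le_sup_left))
  refine (key (J + 1)).trans (sup_le le_rfl ?_)
  have : c (J + 1) = 0 := by
    refine posPart_eq_zero.2 (sub_nonpos.2 (hb.trans ?_))
    exact nsmul_le_nsmul_left he (by omega)
  rw [this]
  exact Finset.sum_nonneg fun j _ => le_inf (hc0 _) (hf0 _)

/-- The subtraction trick that turns a sequence into a disjoint one. -/
lemma inf_eq_zero_of_smul_le {a b w w' : E} {C : ℝ} (hC : 1 ≤ C) (hw : 0 ≤ w) (hw' : 0 ≤ w')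
    (h : w ≤ (a - C • b)⁺) (h' : w' ≤ (b - C⁻¹ • a)⁺) : w ⊓ w' = 0 := by
  have hC0 : 0 ≤ C := by linarith
  refine inf_eq_zero_of_le hw hw' h ?_ (posPart_inf_posPart_sub_eq_zero a (C • b))
  calc w' ≤ C • w' := le_smul_of_one_le_left hw' hC
    _ ≤ C • (b - C⁻¹ • a)⁺ := smul_le_smul_of_nonneg_left h' hC0
    _ ≤ (C • b - a)⁺ := by
      have hCi : 0 ≤ C⁻¹ := by positivity
      have : (b - C⁻¹ • a)⁺ ≤ C⁻¹ • (C • b - a)⁺ := by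
        refine sup_le ?_ (smul_nonneg hCi (posPart_nonneg _))
        have e : b - C⁻¹ • a = C⁻¹ • (C • b - a) := by
          rw [smul_sub, smul_smul, inv_mul_cancel₀ (by linarith), one_smul]
        rw [e]
        exact smul_le_smul_of_nonneg_left (le_posPart _) hCi
      refine (smul_le_smul_of_nonneg_left this hC0).trans_eq ?_
      rw [smul_smul, mul_inv_cancel₀ (by linarith), one_smul]

end VectorLattice

/-! ### The solid seminorm of an operator and the modulus of a functional -/

section SolidSeminorm

variable {E : Type*} [NormedAddCommGroup E] [NormedSpace ℝ E] [Lattice E]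
  {Y : Type*} [NormedAddCommGroup Y] [NormedSpace ℝ Y]

/-- The largest value of `‖T z‖` for `z` in the order interval `[-|x|, |x|]`. -/
noncomputable def solidSeminorm (T : E →L[ℝ] Y) (x : E) : ℝ :=
  ⨆ z : {z : E // |z| ≤ |x|}, ‖T z‖

lemma solidSeminorm_le (T : E →L[ℝ] Y) {x : E} {c : ℝ} (h : ∀ z, |z| ≤ |x| → ‖T z‖ ≤ c) :
    solidSeminorm T x ≤ c :=
  haveI : Nonempty {z : E // |z| ≤ |x|} := ⟨⟨x, le_rfl⟩⟩
  ciSup_le fun z => h z z.2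

lemma solidSeminorm_nonneg (T : E →L[ℝ] Y) (x : E) : 0 ≤ solidSeminorm T x :=
  Real.iSup_nonneg fun _ => norm_nonneg _

lemma exists_lt_norm_of_lt_solidSeminorm {T : E →L[ℝ] Y} {x : E} {c : ℝ}
    (h : c < solidSeminorm T x) : ∃ z, |z| ≤ |x| ∧ c < ‖T z‖ := by
  by_contra! hc
  exact h.not_ge (solidSeminorm_le T hc)

/-- The supremum need not be attained, but elements reaching half of it can be chosen, and they
inherit disjointness from `w`. -/
lemma tendsto_solidSeminorm_of_isDisjointSeq [IsOrderedAddMonoid E] {T : E →L[ℝ] Y} {w : ℕ → E}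
    (hw : IsDisjointSeq w)
    (h : ∀ z : ℕ → E, IsDisjointSeq z → (∀ n, |z n| ≤ |w n|) →
      Tendsto (fun n => T (z n)) atTop (𝓝 0)) :
    Tendsto (fun n => solidSeminorm T (w n)) atTop (𝓝 0) := by
  have : ∀ n, ∃ z, |z| ≤ |w n| ∧ solidSeminorm T (w n) ≤ 2 * ‖T z‖ := by
    intro n
    rcases (solidSeminorm_nonneg T (w n)).eq_or_lt with h0 | h0
    · exact ⟨w n, le_rfl, by rw [← h0]; positivity⟩
    · obtain ⟨z, hz, hz'⟩ := exists_lt_norm_of_lt_solidSeminorm (half_lt_self h0)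
      exact ⟨z, hz, by linarith⟩
  choose z hz hz' using this
  have hd : IsDisjointSeq z := fun m n hmn =>
    inf_eq_zero_of_le (abs_nonneg _) (abs_nonneg _) (hz m) (hz n) (hw m n hmn)
  have hlim := ((h z hd hz).norm).const_mul 2
  rw [norm_zero, mul_zero] at hlim
  exact squeeze_zero (fun n => solidSeminorm_nonneg T _) hz' hlim

variable [HasSolidNorm E]

lemma norm_le_solidSeminorm (T : E →L[ℝ] Y) {x z : E} (h : |z| ≤ |x|) :
    ‖T z‖ ≤ solidSeminorm T x := by
  refine le_ciSup (f := fun z : {z : E // |z| ≤ |x|} => ‖T z‖) ⟨‖T‖ * ‖x‖, ?_⟩ ⟨z, h⟩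
  rintro _ ⟨w, rfl⟩
  exact (T.le_opNorm _).trans
    (mul_le_mul_of_nonneg_left (norm_le_norm_of_abs_le_abs w.2) (norm_nonneg _))

lemma solidSeminorm_le_opNorm (T : E →L[ℝ] Y) (x : E) : solidSeminorm T x ≤ ‖T‖ * ‖x‖ :=
  solidSeminorm_le T fun _ hz => (T.le_opNorm _).trans
    (mul_le_mul_of_nonneg_left (norm_le_norm_of_abs_le_abs hz) (norm_nonneg _))

lemma solidSeminorm_mono (T : E →L[ℝ] Y) {x y : E} (h : |x| ≤ |y|) :
    solidSeminorm T x ≤ solidSeminorm T y :=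
  solidSeminorm_le T fun _ hz => norm_le_solidSeminorm T (hz.trans h)

lemma solidSeminorm_comp_le (T : E →L[ℝ] Y) {f : Y →L[ℝ] ℝ} (hf : ‖f‖ ≤ 1) (x : E) :
    solidSeminorm (f ∘L T) x ≤ solidSeminorm T x :=
  solidSeminorm_le _ fun z hz => by
    refine (f.le_opNorm _).trans ?_
    refine (mul_le_of_le_one_left (norm_nonneg _) hf).trans (norm_le_solidSeminorm T hz)

lemma exists_lt_solidSeminorm_comp {T : E →L[ℝ] Y} {x : E} {c : ℝ}
    (h : c < solidSeminorm T x) : ∃ f : Y →L[ℝ] ℝ, ‖f‖ ≤ 1 ∧ c < solidSeminorm (f ∘L T) x := by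
  obtain ⟨z, hz, hcz⟩ := exists_lt_norm_of_lt_solidSeminorm h
  obtain ⟨f, hf, hfz⟩ := exists_dual_vector'' ℝ (T z)
  refine ⟨f, hf, hcz.trans_le ?_⟩
  have := norm_le_solidSeminorm (f ∘L T) hz
  rw [ContinuousLinearMap.comp_apply, hfz] at this
  simpa using this

variable [IsOrderedAddMonoid E]

lemma solidSeminorm_mono_of_nonneg (T : E →L[ℝ] Y) {x y : E} (hx : 0 ≤ x) (h : x ≤ y) :
    solidSeminorm T x ≤ solidSeminorm T y :=
  solidSeminorm_mono T (by rwa [abs_of_nonneg hx, abs_of_nonneg (hx.trans h)])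

lemma solidSeminorm_le_add (T : E →L[ℝ] Y) {x a b : E} (ha : 0 ≤ a) (hb : 0 ≤ b)
    (h : |x| ≤ a + b) : solidSeminorm T x ≤ solidSeminorm T a + solidSeminorm T b := by
  refine solidSeminorm_le T fun z hz => ?_
  obtain ⟨z₁, z₂, rfl, h₁, h₂⟩ := exists_add_of_abs_le_add ha hb (hz.trans h)
  rw [map_add]
  exact (norm_add_le _ _).trans (add_le_add
    (norm_le_solidSeminorm T (h₁.trans (le_abs_self a)))
    (norm_le_solidSeminorm T (h₂.trans (le_abs_self b))))

lemma solidSeminorm_sum_le (T : E →L[ℝ] Y) {ι : Type*} (s : Finset ι) {a : ι → E}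
    (ha : ∀ i, 0 ≤ a i) : solidSeminorm T (∑ i ∈ s, a i) ≤ ∑ i ∈ s, solidSeminorm T (a i) := by
  classical
  induction s using Finset.induction_on with
  | empty => simpa using solidSeminorm_le_opNorm T 0
  | insert k s hk ih =>
    rw [Finset.sum_insert hk, Finset.sum_insert hk]
    refine (solidSeminorm_le_add T (ha k) (Finset.sum_nonneg fun i _ => ha i) ?_).trans
      (add_le_add_right ih _)
    rw [abs_of_nonneg (add_nonneg (ha k) (Finset.sum_nonneg fun i _ => ha i))]

/-- For scalar values the signs of `g z` and `g w` can be aligned by replacing `w` with `-w`, so the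
two suprema are reached together. -/
lemma solidSeminorm_add (g : E →L[ℝ] ℝ) {a b : E} (ha : 0 ≤ a) (hb : 0 ≤ b) :
    solidSeminorm g (a + b) = solidSeminorm g a + solidSeminorm g b := by
  refine le_antisymm (solidSeminorm_le_add g ha hb (abs_of_nonneg (add_nonneg ha hb)).le) ?_
  rw [← le_sub_iff_add_le]
  refine solidSeminorm_le g fun z hz => ?_
  rw [le_sub_comm]
  refine solidSeminorm_le g fun w hw => ?_
  rw [le_sub_iff_add_le']
  rw [abs_of_nonneg ha] at hz
  rw [abs_of_nonneg hb] at hw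
  have key : ∀ w, |w| ≤ b → |g z + g w| ≤ solidSeminorm g (a + b) := fun w hw => by
    rw [← map_add, ← Real.norm_eq_abs]
    refine norm_le_solidSeminorm g ?_
    rw [abs_of_nonneg (add_nonneg ha hb)]
    exact (abs_add_le z w).trans (add_le_add hz hw)
  have h₁ := abs_le.1 (key w hw)
  have h₂ := abs_le.1 (key (-w) (by rwa [abs_neg]))
  rw [map_neg] at h₂
  rw [Real.norm_eq_abs, Real.norm_eq_abs]
  rcases abs_cases (g z) with ⟨e, _⟩ | ⟨e, _⟩ <;> rcases abs_cases (g w) with ⟨e', _⟩ | ⟨e', _⟩ <;>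
    rw [e, e'] <;> linarith [h₁.1, h₁.2, h₂.1, h₂.2]

/-- The modulus of a continuous functional (Riesz–Kantorovich). -/
lemma exists_modulus (g : E →L[ℝ] ℝ) :
    ∃ F : E →L[ℝ] ℝ, ∀ x, 0 ≤ x → F x = solidSeminorm g x := by
  have hadd : ∀ x y : E, solidSeminorm g (x + y)⁺ - solidSeminorm g (x + y)⁻ =
      (solidSeminorm g x⁺ - solidSeminorm g x⁻) +
        (solidSeminorm g y⁺ - solidSeminorm g y⁻) := by
    intro x y
    have h : (x + y)⁺ + (x⁻ + y⁻) = (x + y)⁻ + (x⁺ + y⁺) := by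
      have h₁ := posPart_sub_negPart (x + y)
      have h₂ := posPart_sub_negPart x
      have h₃ := posPart_sub_negPart y
      have h₄ : (x + y)⁺ = (x + y)⁻ + (x + y) := by rw [← sub_eq_iff_eq_add', h₁]
      have h₅ : x⁺ = x⁻ + x := by rw [← sub_eq_iff_eq_add', h₂]
      have h₆ : y⁺ = y⁻ + y := by rw [← sub_eq_iff_eq_add', h₃]
      rw [h₄, h₅, h₆]; abel
    have h' := congrArg (solidSeminorm g) h
    have p := fun z : E => posPart_nonneg z
    have n := fun z : E => negPart_nonneg z
    rw [solidSeminorm_add g (p _) (add_nonneg (n _) (n _)), solidSeminorm_add g (n _) (n _),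
      solidSeminorm_add g (n _) (add_nonneg (p _) (p _)), solidSeminorm_add g (p _) (p _)] at h'
    linarith
  -- Additivity and continuity already force real linearity, so homogeneity needs no separate check.
  let φ : E →+ ℝ := AddMonoidHom.mk' (fun x => solidSeminorm g x⁺ - solidSeminorm g x⁻) hadd
  have hφ : Continuous φ := by
    refine AddMonoidHomClass.continuous_of_bound φ ‖g‖ fun x => ?_
    have h₁ : solidSeminorm g x⁺ ≤ ‖g‖ * ‖x‖ :=
      (solidSeminorm_mono g (by
        rw [abs_of_nonneg (posPart_nonneg x), ← posPart_add_negPart]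
        exact le_add_of_nonneg_right (negPart_nonneg x))).trans (solidSeminorm_le_opNorm g x)
    have h₂ : solidSeminorm g x⁻ ≤ ‖g‖ * ‖x‖ :=
      (solidSeminorm_mono g (by
        rw [abs_of_nonneg (negPart_nonneg x), ← posPart_add_negPart]
        exact le_add_of_nonneg_left (posPart_nonneg x))).trans (solidSeminorm_le_opNorm g x)
    have h₃ := solidSeminorm_nonneg g x⁺
    have h₄ := solidSeminorm_nonneg g x⁻
    change |solidSeminorm g x⁺ - solidSeminorm g x⁻| ≤ _
    exact abs_sub_le_iff.2 ⟨by linarith, by linarith⟩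
  refine ⟨φ.toRealLinearMap hφ, fun x hx => ?_⟩
  change solidSeminorm g x⁺ - solidSeminorm g x⁻ = _
  have h0 : solidSeminorm g (0 : E) = 0 :=
    le_antisymm (by simpa using solidSeminorm_le_opNorm g (0 : E)) (solidSeminorm_nonneg g 0)
  rw [posPart_of_nonneg hx, negPart_of_nonneg hx, h0, sub_zero]

end SolidSeminorm

/-! ### Weak compactness and the gliding hump -/

section WeakTopology

variable {E : Type*} [NormedAddCommGroup E] [NormedSpace ℝ E]

lemma tendsto_toWeakSpace_iff {ι : Type*} {l : Filter ι} {x : ι → E} {a : E} :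
    Tendsto (fun i => toWeakSpace ℝ E (x i)) l (𝓝 (toWeakSpace ℝ E a)) ↔
      ∀ f : E →L[ℝ] ℝ, Tendsto (fun i => f (x i)) l (𝓝 (f a)) :=
  WeakBilin.tendsto_iff_forall_eval_tendsto (topDualPairing ℝ E).flip fun _ _ h => by
    by_contra hne
    obtain ⟨f, hf⟩ := SeparatingDual.exists_separating_of_ne (R := ℝ) hne
    exact hf (DFunLike.congr_fun h f)

lemma IsRelativelyWeaklyCompact.exists_tendsto_ultrafilter {S : Set E}
    (hS : IsRelativelyWeaklyCompact S) {ι : Type*} (U : Ultrafilter ι) {y : ι → E}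
    (hy : ∀ i, y i ∈ S) : ∃ b, ∀ f : E →L[ℝ] ℝ, Tendsto (fun i => f (y i)) U (𝓝 (f b)) := by
  obtain ⟨a, -, ha⟩ := hS.ultrafilter_le_nhds (U.map fun i => toWeakSpace ℝ E (y i))
    (by
      rw [le_principal_iff]
      exact mem_map.2 (univ_mem' fun i => subset_closure ⟨y i, hy i, rfl⟩))
  obtain ⟨b, rfl⟩ := (toWeakSpace ℝ E).surjective a
  exact ⟨b, tendsto_toWeakSpace_iff.1 ha⟩

/-- Each functional is bounded on the weakly compact closure; uniform boundedness in the bidual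
gives the norm bound. -/
lemma IsRelativelyWeaklyCompact.exists_norm_le {S : Set E} (hS : IsRelativelyWeaklyCompact S) :
    ∃ C, ∀ x ∈ S, ‖x‖ ≤ C := by
  have hb : ∀ f : E →L[ℝ] ℝ, ∃ C, ∀ x : S, ‖NormedSpace.inclusionInDoubleDual ℝ E x f‖ ≤ C := by
    intro f
    have hf : Continuous fun w : WeakSpace ℝ E => f ((toWeakSpace ℝ E).symm w) :=
      WeakBilin.eval_continuous (topDualPairing ℝ E).flip f
    obtain ⟨C, hC⟩ := (hS.image hf).isBounded.exists_norm_le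
    exact ⟨C, fun x => hC _ ⟨toWeakSpace ℝ E x, subset_closure ⟨x, x.2, rfl⟩, rfl⟩⟩
  obtain ⟨C, hC⟩ := banach_steinhaus hb
  refine ⟨C, fun x hx => ?_⟩
  rw [← (NormedSpace.inclusionInDoubleDualLi ℝ (E := E)).norm_map x]
  exact hC ⟨x, hx⟩

lemma isRelativelyWeaklyCompact_range_of_tendsto {x : ℕ → E}
    (hx : Tendsto (fun n => toWeakSpace ℝ E (x n)) atTop (𝓝 (toWeakSpace ℝ E 0))) :
    IsRelativelyWeaklyCompact (Set.range x) := by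
  refine hx.isCompact_insert_range.closure_of_subset ?_
  rw [← Set.range_comp]
  exact Set.subset_insert _ _

lemma isRelativelyWeaklyCompact_singleton (x : E) : IsRelativelyWeaklyCompact {x} := by
  rw [IsRelativelyWeaklyCompact, Set.image_singleton, closure_singleton]
  exact isCompact_singleton

/-- The multiplier `τ`, an element of the unit ball of `ℓ^∞`, is pulled back along the operator `v ↦
(gₙ v)ₙ` into `ℓ¹`. -/
lemma exists_tsum_functional {g : ℕ → E →L[ℝ] ℝ} {C : ℝ}
    (hg : ∀ y (s : Finset ℕ), ∑ n ∈ s, |g n y| ≤ C * ‖y‖) {τ : ℕ → ℝ} (hτ : ∀ j, |τ j| ≤ 1) :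
    ∃ G : E →L[ℝ] ℝ, ∀ v, G v = ∑' j, τ j * g j v := by
  have hsum : ∀ v, Summable fun n => |g n v| := fun v =>
    summable_of_sum_le (fun _ => abs_nonneg _) (hg v)
  have hτg : ∀ v j, ‖τ j * g j v‖ ≤ |g j v| := fun v j => by
    rw [Real.norm_eq_abs, abs_mul]
    exact mul_le_of_le_one_left (abs_nonneg _) (hτ j)
  have hsumτ : ∀ v, Summable fun j => τ j * g j v := fun v =>
    Summable.of_norm_bounded (hsum v) (hτg v)
  let G : E →ₗ[ℝ] ℝ :=
    { toFun := fun v => ∑' j, τ j * g j v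
      map_add' := fun v w => by
        simp only [map_add, mul_add]
        exact (hsumτ v).tsum_add (hsumτ w)
      map_smul' := fun r v => by
        simp only [map_smul, smul_eq_mul, mul_left_comm _ r, RingHom.id_apply]
        exact tsum_mul_left }
  refine ⟨G.mkContinuous C fun v => ?_, fun _ => rfl⟩
  exact (tsum_of_norm_bounded (hsum v).hasSum (hτg v)).trans ((hsum v).tsum_le_of_sum_le (hg v))

lemma sub_tail_le_tsum {a c : ℕ → ℝ} (hc : Summable c) (hac : ∀ j, |a j| ≤ c j) {N n N' : ℕ}
    (hn : N < n) (hn' : n ≤ N') (hzero : ∀ j, N < j → j ≤ N' → j ≠ n → a j = 0) :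
    a n - ∑ j ∈ Finset.range (N + 1), c j - ∑' j, c (j + (N' + 1)) ≤ ∑' j, a j := by
  have ha : Summable a := Summable.of_norm_bounded hc hac
  have h₁ : |∑ j ∈ Finset.range (N + 1), a j| ≤ ∑ j ∈ Finset.range (N + 1), c j :=
    (Finset.abs_sum_le_sum_abs _ _).trans (Finset.sum_le_sum fun j _ => hac j)
  have h₂ : |∑' j, a (j + (N' + 1))| ≤ ∑' j, c (j + (N' + 1)) :=
    tsum_of_norm_bounded (f := fun j => a (j + (N' + 1)))
      ((summable_nat_add_iff (N' + 1)).2 hc).hasSum fun j => hac (j + (N' + 1))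
  have h₃ : ∑ j ∈ Finset.Ico (N + 1) (N' + 1), a j = a n := by
    refine Finset.sum_eq_single n (fun j hj hne => ?_) fun h => ?_
    · rw [Finset.mem_Ico] at hj
      exact hzero j (by omega) (by omega) hne
    · exact absurd (Finset.mem_Ico.2 ⟨by omega, by omega⟩) h
  rw [← ha.sum_add_tsum_nat_add (N' + 1),
    ← Finset.sum_range_add_sum_Ico _ (show N + 1 ≤ N' + 1 by omega), h₃]
  linarith [(abs_le.1 h₁).1, (abs_le.1 h₂).1]

/-- A functional-valued form of the Schur property of `ℓ¹`: if `y ↦ (gₙ y)ₙ` is a bounded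
operator into `ℓ¹`, then the coordinates tend to zero uniformly on relatively weakly compact
sets. -/
lemma IsRelativelyWeaklyCompact.tendsto_apply_of_sum_abs_le {S : Set E}
    (hS : IsRelativelyWeaklyCompact S) {g : ℕ → E →L[ℝ] ℝ} {C : ℝ}
    (hg : ∀ y (s : Finset ℕ), ∑ n ∈ s, |g n y| ≤ C * ‖y‖) {y : ℕ → E} (hy : ∀ n, y n ∈ S) :
    Tendsto (fun n => g n (y n)) atTop (𝓝 0) := by
  have hsum : ∀ v, Summable fun n => |g n v| := fun v =>
    summable_of_sum_le (fun _ => abs_nonneg _) (hg v)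
  by_contra hcon
  obtain ⟨ε, hε, hbad⟩ : ∃ ε > 0, ∃ᶠ n in atTop, ε ≤ |g n (y n)| := by
    rw [Metric.tendsto_nhds] at hcon
    push Not at hcon
    simpa [dist_zero_right] using hcon
  -- a weak cluster point `b` of the bad terms
  set F : Filter ℕ := atTop ⊓ 𝓟 {n | ε ≤ |g n (y n)|} with hF
  have : F.NeBot := frequently_mem_iff_neBot.1 hbad
  obtain ⟨b, hb⟩ := hS.exists_tendsto_ultrafilter (Ultrafilter.of F) hy
  have hUle : (Ultrafilter.of F : Filter ℕ) ≤ F := Ultrafilter.of_le F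
  set z : ℕ → E := fun n => y n - b with hz
  -- Past any `N` there is a bad index whose vector `z` has small head up to `N` and small tail
  -- beyond `p.2`. Subtracting `b` costs at most `ε / 8` of the value at that index.
  have hstep : ∀ N : ℕ, ∃ p : ℕ × ℕ, N < p.1 ∧ p.1 ≤ p.2 ∧ 7 / 8 * ε ≤ |g p.1 (z p.1)| ∧
      ∑ j ∈ Finset.range (N + 1), |g j (z p.1)| < 1 / ((N : ℝ) + 1) ∧
      ∑' j, |g (j + (p.2 + 1)) (z p.1)| < ε / 8 := by
    intro N
    have h₁ : ∀ᶠ n in (Ultrafilter.of F : Filter ℕ), N < n :=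
      hUle (mem_inf_of_left (eventually_gt_atTop N))
    have h₂ : ∀ᶠ n in (Ultrafilter.of F : Filter ℕ), ε ≤ |g n (y n)| :=
      hUle (mem_inf_of_right (mem_principal_self _))
    have h₃ : ∀ᶠ n in (Ultrafilter.of F : Filter ℕ), |g n b| < ε / 8 :=
      hUle (mem_inf_of_left ((hsum b).tendsto_atTop_zero.eventually_lt_const
        (by positivity)))
    have h₄ : ∀ᶠ n in (Ultrafilter.of F : Filter ℕ),
        ∑ j ∈ Finset.range (N + 1), |g j (z n)| < 1 / ((N : ℝ) + 1) := by
      have : Tendsto (fun n => ∑ j ∈ Finset.range (N + 1), |g j (z n)|)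
          (Ultrafilter.of F : Filter ℕ) (𝓝 (∑ j ∈ Finset.range (N + 1), |g j b - g j b|)) := by
        refine tendsto_finsetSum _ fun j _ => ?_
        simp only [hz, map_sub]
        exact ((hb (g j)).sub_const _).abs
      simp only [sub_self, abs_zero, Finset.sum_const_zero] at this
      exact this.eventually_lt_const (by positivity)
    obtain ⟨n, ⟨hn₁, hn₂⟩, hn₃, hn₄⟩ := ((h₁.and h₂).and (h₃.and h₄)).exists
    have h₅ := (tendsto_sum_nat_add fun j => |g j (z n)|).comp (tendsto_add_atTop_nat 1)
    obtain ⟨N', hN', hN''⟩ := ((h₅.eventually_lt_const (show 0 < ε / 8 by positivity)).and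
      (eventually_ge_atTop n)).exists
    refine ⟨(n, N'), hn₁, hN'', ?_, hn₄, hN'⟩
    have : |g n (y n)| ≤ |g n (z n)| + |g n b| := by
      simpa [hz] using abs_add_le (g n (z n)) (g n b)
    dsimp only
    linarith
  choose P hP₁ hP₂ hP₃ hP₄ hP₅ using hstep
  obtain ⟨N₀, hN₀⟩ := exists_nat_one_div_lt (show 0 < ε / 8 by positivity)
  -- the gliding hump
  obtain ⟨M, hM0, hMs⟩ : ∃ M : ℕ → ℕ, M 0 = N₀ ∧ ∀ k, M (k + 1) = (P (M k)).2 :=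
    ⟨fun k => Nat.rec N₀ (fun _ m => (P m).2) k, rfl, fun _ => rfl⟩
  set m : ℕ → ℕ := fun k => (P (M k)).1 with hm
  have hMm : ∀ k, M k < m k := fun k => hP₁ (M k)
  have hmM : ∀ k, m k ≤ M (k + 1) := fun k => (hMs k).symm ▸ hP₂ (M k)
  have hMmono : StrictMono M := strictMono_nat_of_lt_succ fun k => (hMm k).trans_le (hmM k)
  have hm_unique : ∀ k i, M k < m i → m i ≤ M (k + 1) → i = k := by
    intro k i h₁ h₂
    by_contra hne
    rcases lt_or_gt_of_ne hne with h | h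
    · exact absurd (h₁.trans_le ((hmM i).trans (hMmono.monotone h))) (lt_irrefl _)
    · exact absurd ((hMmono.monotone h).trans_lt (hMm i) |>.trans_le h₂) (lt_irrefl _)
  classical
  -- The signs are chosen so that each hump contributes its absolute value to `G`.
  set τ : ℕ → ℝ := fun j => if j ∈ Set.range m then (SignType.sign (g j (z j)) : ℝ) else 0 with hτ
  have hτ1 : ∀ j, |τ j| ≤ 1 := by
    intro j
    simp only [hτ]
    split_ifs
    · cases SignType.sign (g j (z j)) <;> simp
    · simp
  have hτg : ∀ v j, |τ j * g j v| ≤ |g j v| := fun v j => by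
    rw [abs_mul]
    exact mul_le_of_le_one_left (abs_nonneg _) (hτ1 j)
  obtain ⟨G, hG⟩ := exists_tsum_functional hg hτ1
  have hsmall : ∀ k, 1 / ((M k : ℝ) + 1) < ε / 8 := fun k =>
    (one_div_le_one_div_of_le (by positivity)
      (add_le_add_left (Nat.cast_le.2 (hM0 ▸ hMmono.monotone (Nat.zero_le k))) 1)).trans_lt hN₀
  -- The hump gives `7ε/8`; the head and the tail cost less than `ε/8` each.
  have hlow : ∀ k, ε / 2 ≤ G (z (m k)) := by
    intro k
    have hzero : ∀ j, M k < j → j ≤ M (k + 1) → j ≠ m k → τ j * g j (z (m k)) = 0 := by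
      intro j h₁ h₂ hne
      have : j ∉ Set.range m := by
        rintro ⟨i, rfl⟩
        exact hne (by rw [hm_unique k i h₁ h₂])
      rw [hτ]
      simp only [this, if_false, zero_mul]
    have h₁ := sub_tail_le_tsum (hsum (z (m k))) (hτg (z (m k))) (hMm k) (hmM k) hzero
    have h₂ : τ (m k) * g (m k) (z (m k)) = |g (m k) (z (m k))| := by
      simp only [hτ, Set.mem_range_self, if_true]
      exact sign_mul_self _
    have h₃ := hP₃ (M k)
    have h₄ := (hP₄ (M k)).trans (hsmall k)
    have h₅ := hP₅ (M k)
    rw [← hMs k] at h₅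
    rw [h₂] at h₁
    rw [hG]
    change _ ≤ |g (m k) (z (m k))| at h₃
    linarith
  -- a weak cluster point of the hump sequence
  set U : Ultrafilter ℕ := Ultrafilter.of atTop
  obtain ⟨b', hb'⟩ := hS.exists_tendsto_ultrafilter U fun k => hy (m k)
  -- The heads of the humps vanish in the limit, so `b'` and `b` have the same coordinates and `G`
  -- cannot tell them apart, against `hlow`.
  have hgb : ∀ j, g j b' = g j b := by
    intro j
    refine tendsto_nhds_unique (hb' (g j)) (Tendsto.mono_left ?_ (Ultrafilter.of_le atTop))
    have h0 : Tendsto (fun k => g j (z (m k))) atTop (𝓝 0) := by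
      refine squeeze_zero_norm' ?_ ((tendsto_one_div_add_atTop_nhds_zero_nat (𝕜 := ℝ)).comp
        hMmono.tendsto_atTop)
      filter_upwards [eventually_ge_atTop j] with k hk
      refine le_trans ?_ (hP₄ (M k)).le
      exact Finset.single_le_sum (f := fun j => |g j (z (m k))|) (fun _ _ => abs_nonneg _)
        (Finset.mem_range.2 (Nat.lt_succ_of_le (hk.trans (hMmono.id_le k))))
    simpa [hz] using h0.add_const (g j b)
  have hGb : G b' = G b := by simp only [hG, hgb]
  have : ε / 2 ≤ G b' - G b :=
    ge_of_tendsto ((hb' G).sub_const (G b))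
      (Eventually.of_forall fun k => by simpa [hz] using hlow k)
  linarith

end WeakTopology

/-! ### Disjoint sequences in solid hulls of weakly compact sets -/

section DisjointWeaklyNull

variable {E : Type*} [NormedAddCommGroup E] [NormedSpace ℝ E] [Lattice E]
  [IsOrderedAddMonoid E] [IsOrderedModule ℝ E]

omit [IsOrderedAddMonoid E] in
lemma abs_smul_le (r : ℝ) (y : E) : |r • y| ≤ |r| • |y| := by
  refine abs_le'.2 ?_
  rcases le_total 0 r with hr | hr
  · rw [abs_of_nonneg hr, ← smul_neg]
    exact ⟨smul_le_smul_of_nonneg_left (le_abs_self y) hr,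
      smul_le_smul_of_nonneg_left (neg_le_abs y) hr⟩
  · rw [abs_of_nonpos hr, ← neg_smul, ← neg_smul_neg r y]
    exact ⟨smul_le_smul_of_nonneg_left (neg_le_abs y) (neg_nonneg.2 hr),
      smul_le_smul_of_nonneg_left (le_abs_self y) (neg_nonneg.2 hr)⟩

omit [IsOrderedAddMonoid E] in
lemma smul_inf_smul_le {t : ℝ} (ht : 0 < t) (a b : E) : t • a ⊓ t • b ≤ t • (a ⊓ b) := by
  have h : t⁻¹ • (t • a ⊓ t • b) ≤ a ⊓ b := by
    refine le_inf ?_ ?_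
    · refine (smul_le_smul_of_nonneg_left inf_le_left (inv_nonneg.2 ht.le)).trans_eq ?_
      rw [smul_smul, inv_mul_cancel₀ ht.ne', one_smul]
    · refine (smul_le_smul_of_nonneg_left inf_le_right (inv_nonneg.2 ht.le)).trans_eq ?_
      rw [smul_smul, inv_mul_cancel₀ ht.ne', one_smul]
  calc t • a ⊓ t • b = t • t⁻¹ • (t • a ⊓ t • b) := by
        rw [smul_smul, mul_inv_cancel₀ ht.ne', one_smul]
    _ ≤ _ := smul_le_smul_of_nonneg_left h ht.le

lemma nsmul_inf_nsmul_eq_zero {e f : E} (he : 0 ≤ e) (hf : 0 ≤ f) (h : e ⊓ f = 0) (k : ℕ) :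
    k • e ⊓ k • f = 0 := by
  refine le_antisymm ?_ (le_inf (nsmul_nonneg he k) (nsmul_nonneg hf k))
  rcases Nat.eq_zero_or_pos k with rfl | hk
  · simp
  · rw [← Nat.cast_smul_eq_nsmul ℝ, ← Nat.cast_smul_eq_nsmul ℝ]
    refine (smul_inf_smul_le (Nat.cast_pos.2 hk) e f).trans_eq ?_
    rw [h, smul_zero]

section Carrier

variable (F : E →L[ℝ] ℝ) (hF : ∀ x, 0 ≤ x → 0 ≤ F x) (e : E) (he : 0 ≤ e)
include hF

omit [IsOrderedModule ℝ E] in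
lemma functional_mono {x y : E} (h : x ≤ y) : F x ≤ F y := by
  have := hF _ (sub_nonneg.2 h)
  rwa [map_sub, sub_nonneg] at this

omit [IsOrderedModule ℝ E] in
lemma bddAbove_carrier (y : E) : BddAbove (Set.range fun k : ℕ => F (|y| ⊓ k • e)) :=
  ⟨F |y|, by rintro _ ⟨k, rfl⟩; exact functional_mono F hF inf_le_left⟩

/-- The part of the positive functional `F` carried by the band generated by `e`, applied
to `|y|`. -/
noncomputable def carrierSeminorm : Seminorm ℝ E :=
  Seminorm.ofSMulLE (fun y => ⨆ k : ℕ, F (|y| ⊓ k • e))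
    (by
      have : ∀ k : ℕ, |(0 : E)| ⊓ k • e = 0 := fun k => by
        rw [abs_zero]; exact inf_eq_left.2 (nsmul_nonneg he k)
      simp only [this, map_zero, ciSup_const])
    (fun y z => ciSup_le fun k => by
      refine (functional_mono F hF ((inf_le_inf_right _ (abs_add_le y z)).trans
        (add_inf_le_inf_add_inf (abs_nonneg y) (abs_nonneg z) (nsmul_nonneg he k)))).trans ?_
      rw [map_add]
      exact add_le_add (le_ciSup (bddAbove_carrier F hF e y) k)
        (le_ciSup (bddAbove_carrier F hF e z) k))
    (fun r y => ciSup_le fun k => by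
      rcases eq_or_ne r 0 with rfl | hr
      · rw [zero_smul, abs_zero, inf_eq_left.2 (nsmul_nonneg he k)]
        simp
      · have hr' : 0 < |r| := abs_pos.2 hr
        obtain ⟨m, hm⟩ := exists_nat_ge (k / |r|)
        rw [div_le_iff₀ hr'] at hm
        have h : |r • y| ⊓ k • e ≤ |r| • (|y| ⊓ m • e) := by
          refine le_trans (inf_le_inf (abs_smul_le r y) ?_) (smul_inf_smul_le hr' _ _)
          rw [← Nat.cast_smul_eq_nsmul ℝ, ← Nat.cast_smul_eq_nsmul ℝ, smul_smul, mul_comm]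
          exact smul_le_smul_of_nonneg_right hm he
        refine (functional_mono F hF h).trans ?_
        rw [map_smul, smul_eq_mul, Real.norm_eq_abs]
        exact mul_le_mul_of_nonneg_left (le_ciSup (bddAbove_carrier F hF e y) m) hr'.le)

lemma le_carrierSeminorm (y : E) (k : ℕ) : F (|y| ⊓ k • e) ≤ carrierSeminorm F hF e he y :=
  le_ciSup (bddAbove_carrier F hF e y) k

lemma tendsto_carrierSeminorm (y : E) :
    Tendsto (fun k : ℕ => F (|y| ⊓ k • e)) atTop (𝓝 (carrierSeminorm F hF e he y)) :=
  tendsto_atTop_ciSup (fun _ _ hij => functional_mono F hF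
    (inf_le_inf_left _ (nsmul_le_nsmul_left he hij))) (bddAbove_carrier F hF e y)

/-- At each fixed level `k` the truncations `|y| ⊓ k • e n` are disjoint and below `|y|`, so their
sum is too; then let `k → ∞`. -/
lemma sum_carrierSeminorm_le {e : ℕ → E} (he : ∀ n, 0 ≤ e n)
    (hd : ∀ m n, m ≠ n → e m ⊓ e n = 0) (y : E) (s : Finset ℕ) :
    ∑ n ∈ s, carrierSeminorm F hF (e n) (he n) y ≤ F |y| := by
  refine le_of_tendsto'
    (tendsto_finsetSum s fun n _ => tendsto_carrierSeminorm F hF (e n) (he n) y) fun k => ?_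
  rw [← map_sum]
  refine functional_mono F hF (sum_le_of_pairwise_disjoint (abs_nonneg y)
    (fun n => le_inf (abs_nonneg y) (nsmul_nonneg (he n) k)) (fun _ => inf_le_left) ?_ s)
  intro m n hmn
  exact inf_eq_zero_of_le (le_inf (abs_nonneg y) (nsmul_nonneg (he m) k))
    (le_inf (abs_nonneg y) (nsmul_nonneg (he n) k)) inf_le_right inf_le_right
    (nsmul_inf_nsmul_eq_zero (he m) (he n) (hd m n hmn) k)

end Carrier

lemma exists_functional_eq_seminorm {V : Type*} [AddCommGroup V] [Module ℝ V]
    (q : Seminorm ℝ V) (y : V) : ∃ g : V →ₗ[ℝ] ℝ, g y = q y ∧ ∀ v, |g v| ≤ q v := by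
  have H : ∀ c : ℝ, c • y = 0 → RingHom.id ℝ c • q y = 0 := by
    intro c hc
    have := map_smul_eq_mul q c y
    rw [hc, map_zero, Real.norm_eq_abs] at this
    rcases mul_eq_zero.1 this.symm with h | h
    · rw [abs_eq_zero.1 h]; simp
    · rw [h]; simp
  obtain ⟨g, hg, hle⟩ := exists_extension_of_le_sublinear
    (LinearPMap.mkSpanSingleton' y (q y) H) q
    (fun c hc v => by rw [map_smul_eq_mul, Real.norm_of_nonneg hc.le])
    (fun u v => map_add_le_add q u v) (by
      rintro ⟨v, hv⟩
      obtain ⟨c, rfl⟩ := Submodule.mem_span_singleton.1 hv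
      rw [LinearPMap.mkSpanSingleton'_apply, map_smul_eq_mul]
      exact mul_le_mul_of_nonneg_right (le_abs_self c) (apply_nonneg q y))
  have hy : y ∈ (LinearPMap.mkSpanSingleton' y (q y) H).domain :=
    Submodule.mem_span_singleton_self y
  exact ⟨g, (hg ⟨y, hy⟩).trans (LinearPMap.mkSpanSingleton'_apply_self _ _ _ hy), q.abs_le_of_le hle⟩

variable [HasSolidNorm E]

/-- Disjoint sequences in the solid hull of a relatively weakly compact set are weakly null. -/
lemma IsRelativelyWeaklyCompact.tendsto_of_isDisjointSeq {S : Set E}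
    (hS : IsRelativelyWeaklyCompact S) {x : ℕ → E} (hx : IsDisjointSeq x)
    (hxS : ∀ n, x n ∈ sol S) (f : E →L[ℝ] ℝ) : Tendsto (fun n => f (x n)) atTop (𝓝 0) := by
  obtain ⟨F, hFf⟩ := exists_modulus f
  have hF : ∀ x, 0 ≤ x → 0 ≤ F x := fun x h => (hFf x h).symm ▸ solidSeminorm_nonneg f x
  choose y hyS hxy using hxS
  have habs : ∀ n, 0 ≤ |x n| := fun n => abs_nonneg _
  -- Hahn–Banach replaces each seminorm by a dominated functional that agrees with it at `y n`, as
  -- an operator into `ℓ¹` needs linear coordinates.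
  choose g₀ hg₀ hg₀le using fun n =>
    exists_functional_eq_seminorm (carrierSeminorm F hF |x n| (habs n)) (y n)
  have hsum : ∀ v (s : Finset ℕ), ∑ n ∈ s, |g₀ n v| ≤ ‖F‖ * ‖v‖ := fun v s =>
    calc ∑ n ∈ s, |g₀ n v| ≤ _ := Finset.sum_le_sum fun n _ => hg₀le n v
      _ ≤ F |v| := sum_carrierSeminorm_le F hF habs hx v s
      _ ≤ ‖F‖ * ‖|v|‖ := (le_abs_self _).trans (F.le_opNorm _)
      _ = _ := by rw [norm_abs_eq_norm]
  let g : ℕ → E →L[ℝ] ℝ := fun n => (g₀ n).mkContinuous ‖F‖ fun v => by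
    simpa using hsum v {n}
  refine squeeze_zero_norm (fun n => ?_)
    (hS.tendsto_apply_of_sum_abs_le (g := g) (C := ‖F‖) hsum hyS)
  calc ‖f (x n)‖ ≤ solidSeminorm f |x n| := norm_le_solidSeminorm f (abs_abs _).ge
    _ = F |x n| := (hFf _ (habs n)).symm
    _ = F (|y n| ⊓ 1 • |x n|) := by rw [one_smul, inf_eq_right.2 (hxy n)]
    _ ≤ carrierSeminorm F hF |x n| (habs n) (y n) := le_carrierSeminorm F hF _ (habs n) _ 1
    _ = g n (y n) := (hg₀ n).symm

end DisjointWeaklyNull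

/-! ### Weakly null families in order intervals -/

section OrderBounded

variable {E : Type*} [NormedAddCommGroup E] [NormedSpace ℝ E] [Lattice E]
  [IsOrderedAddMonoid E] [IsOrderedModule ℝ E] [HasSolidNorm E]
  {Y : Type*} [NormedAddCommGroup Y] [NormedSpace ℝ Y] {T : E →L[ℝ] Y}

/-- `T` is null on every order bounded disjoint sequence. -/
def IsNullOnOrderBoundedDisjoint (T : E →L[ℝ] Y) : Prop :=
  ∀ (u : E) (z : ℕ → E), IsDisjointSeq z → (∀ n, |z n| ≤ u) →
    Tendsto (fun n => T (z n)) atTop (𝓝 0)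

omit [IsOrderedModule ℝ E] [HasSolidNorm E] in
-- For `m < n`, the `m`-th piece lives where `v n` exceeds `j • e` and the `n`-th where `v n` is
-- below it: a fixed layer is crossed disjointly.
lemma tendsto_solidSeminorm_layer (hT : IsNullOnOrderBoundedDisjoint T) {u e : E}
    {v : ℕ → E} (hv : Monotone v) (hu : ∀ n, v n ≤ u) (h0 : ∀ n, 0 ≤ v n) (he : 0 ≤ e) (j : ℕ) :
    Tendsto (fun n => solidSeminorm T ((v (n + 1) - (j + 1) • e)⁺ ⊓ (j • e - v n)⁺))
      atTop (𝓝 0) := by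
  set w : ℕ → E := fun n => (v (n + 1) - (j + 1) • e)⁺ ⊓ (j • e - v n)⁺ with hw
  have hw0 : ∀ n, 0 ≤ w n := fun n => le_inf (posPart_nonneg _) (posPart_nonneg _)
  have hwu : ∀ n, w n ≤ u := fun n => inf_le_left.trans <| sup_le
    ((sub_le_self _ (nsmul_nonneg he _)).trans (hu _)) ((h0 0).trans (hu 0))
  have hlt : ∀ m n, m < n → w m ⊓ w n = 0 := by
    intro m n hmn
    refine inf_eq_zero_of_le (hw0 m) (hw0 n) (inf_le_left.trans (posPart_mono ?_)) inf_le_right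
      (posPart_inf_posPart_sub_eq_zero (v n) (j • e))
    exact sub_le_sub (hv hmn) (nsmul_le_nsmul_left he (Nat.le_succ j))
  refine tendsto_solidSeminorm_of_isDisjointSeq (fun m n hmn => ?_) fun z hz hzw =>
    hT u z hz fun n => (hzw n).trans ((abs_of_nonneg (hw0 n)).trans_le (hwu n))
  rw [abs_of_nonneg (hw0 m), abs_of_nonneg (hw0 n)]
  rcases lt_or_gt_of_ne hmn with h | h
  · exact hlt m n h
  · rw [inf_comm]; exact hlt n m h

lemma tendsto_solidSeminorm_succ_sub (hT : IsNullOnOrderBoundedDisjoint T) {u : E}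
    {v : ℕ → E} (hv : Monotone v) (h0 : ∀ n, 0 ≤ v n) (hu : ∀ n, v n ≤ u) :
    Tendsto (fun n => solidSeminorm T (v (n + 1) - v n)) atTop (𝓝 0) := by
  rw [Metric.tendsto_nhds]
  intro ε hε
  have hu0 : 0 ≤ u := (h0 0).trans (hu 0)
  -- With `e = u / J`, this makes the error `2 • e` cost at most `ε / 2`.
  obtain ⟨J, hJ⟩ := exists_nat_gt (4 * (‖T‖ * ‖u‖) / ε)
  have hJ0 : (0 : ℝ) < J := lt_of_le_of_lt (by positivity) hJ
  set e : E := (J : ℝ)⁻¹ • u with he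
  have he0 : 0 ≤ e := smul_nonneg (by positivity) hu0
  have hJe : J • e = u := by
    rw [he, ← Nat.cast_smul_eq_nsmul ℝ, smul_smul, mul_inv_cancel₀ hJ0.ne', one_smul]
  have hpe : solidSeminorm T (2 • e) ≤ ε / 2 := by
    refine (solidSeminorm_le_opNorm T _).trans ?_
    have : ‖2 • e‖ = 2 * ((J : ℝ)⁻¹ * ‖u‖) := by
      rw [he, ← Nat.cast_smul_eq_nsmul ℝ, norm_smul, norm_smul, norm_inv]
      simp
    rw [this]
    rw [div_lt_iff₀ hε] at hJ
    have h : ‖T‖ * (2 * ((J : ℝ)⁻¹ * ‖u‖)) = (2 * (‖T‖ * ‖u‖)) / J := by ring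
    rw [h, div_le_iff₀ hJ0]
    linarith
  have hlim : Tendsto (fun n => ∑ j ∈ Finset.range (J + 1),
      solidSeminorm T ((v (n + 1) - (j + 1) • e)⁺ ⊓ (j • e - v n)⁺)) atTop (𝓝 0) := by
    have := tendsto_finsetSum (Finset.range (J + 1)) fun j _ =>
      tendsto_solidSeminorm_layer hT hv hu h0 he0 j
    simpa using this
  filter_upwards [hlim.eventually_lt_const (show 0 < ε / 4 by positivity)] with n hn
  rw [Real.dist_0_eq_abs, abs_of_nonneg (solidSeminorm_nonneg T _)]
  set d : E := (1 / 2 : ℝ) • (v (n + 1) - v n - 2 • e)⁺ with hd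
  have hd0 : 0 ≤ d := smul_nonneg (by norm_num) (posPart_nonneg _)
  have hdd : d + d = (v (n + 1) - v n - 2 • e)⁺ := by
    rw [hd, ← add_smul]; norm_num
  have hpd : solidSeminorm T d < ε / 4 :=
    ((solidSeminorm_mono_of_nonneg T hd0
      (half_smul_posPart_le_sum_layers he0 (h0 n) J ((hu _).trans_eq hJe.symm))).trans
      (solidSeminorm_sum_le T _ fun j => le_inf (posPart_nonneg _) (posPart_nonneg _))).trans_lt hn
  have h₁ : solidSeminorm T (d + d) ≤ solidSeminorm T d + solidSeminorm T d :=
    solidSeminorm_le_add T hd0 hd0 (abs_of_nonneg (add_nonneg hd0 hd0)).le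
  have h₂ : solidSeminorm T (v (n + 1) - v n) ≤ solidSeminorm T (d + d) +
      solidSeminorm T (2 • e) := by
    refine solidSeminorm_le_add T (add_nonneg hd0 hd0) (nsmul_nonneg he0 2) ?_
    rw [abs_of_nonneg (sub_nonneg.2 (hv (Nat.le_succ n))), hdd]
    exact sub_le_iff_le_add.1 (le_posPart _)
  linarith

/-- Otherwise a subsequence would have increments bounded below, against
`tendsto_solidSeminorm_succ_sub`. -/
lemma exists_forall_solidSeminorm_sub_le (hT : IsNullOnOrderBoundedDisjoint T) {u : E}
    {v : ℕ → E} (hv : Monotone v) (h0 : ∀ n, 0 ≤ v n) (hu : ∀ n, v n ≤ u) {ε : ℝ} (hε : 0 < ε) :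
    ∃ N, ∀ n ≥ N, solidSeminorm T (v n - v N) ≤ ε := by
  by_contra! hcon
  choose c hc hcε using hcon
  obtain ⟨φ, hφ⟩ : ∃ φ : ℕ → ℕ, ∀ k, φ (k + 1) = c (φ k) :=
    ⟨fun k => Nat.rec 0 (fun _ m => c m) k, fun _ => rfl⟩
  have hφm : Monotone φ := monotone_nat_of_le_succ fun k => (hφ k).symm ▸ hc (φ k)
  have hlim := tendsto_solidSeminorm_succ_sub hT (hv.comp hφm) (fun _ => h0 _) (fun _ => hu _)
  obtain ⟨k, hk⟩ := (hlim.eventually_lt_const hε).exists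
  simp only [Function.comp_apply, hφ] at hk
  exact (hcε (φ k)).not_gt hk

omit [IsOrderedModule ℝ E] [HasSolidNorm E] in
lemma map_partialSups_le_of_geometric {G : E →L[ℝ] ℝ} (hG : ∀ x, 0 ≤ x → 0 ≤ G x) {y : ℕ → E}
    (hy0 : ∀ n, 0 ≤ y n) {j : ℕ} (hGy : ∀ n, j ≤ n → G (y n) ≤ (1 / 2) ^ n) (k : ℕ) :
    G (partialSups (fun i => y (j + i)) k) ≤ (1 / 2) ^ j * 2 := by
  have hle : partialSups (fun i => y (j + i)) k ≤ ∑ t ∈ Finset.range (k + 1), y (j + t) :=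
    partialSups_le _ _ _ fun i hi => Finset.single_le_sum (f := fun t => y (j + t))
      (fun t _ => hy0 (j + t)) (Finset.mem_range.2 (Nat.lt_succ_of_le hi))
  refine (functional_mono G hG hle).trans ?_
  rw [map_sum]
  refine (Finset.sum_le_sum fun t _ => hGy (j + t) (Nat.le_add_right j t)).trans ?_
  simp only [pow_add]
  rw [← Finset.mul_sum]
  exact mul_le_mul_of_nonneg_left (sum_geometric_two_le _) (by positivity)

/-- A substitute for `limsup y` without order completeness. Finite suprema `v j` nearly dominate all
`y n` with `n ≥ j`, and `s n = v 0 ⊓ ⋯ ⊓ v n` decreases and is `p`-Cauchy. So `y N` is nearly below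
`s N`, which is near `s n` for `n > N`, while `G N (s n) ≤ G N (v n)` is geometrically small. -/
lemma not_forall_lt_of_geometric (hT : IsNullOnOrderBoundedDisjoint T) {u : E} {y : ℕ → E}
    (hy0 : ∀ n, 0 ≤ y n) (hyu : ∀ n, y n ≤ u) {G : ℕ → E →L[ℝ] ℝ}
    (hG : ∀ n x, 0 ≤ x → 0 ≤ G n x) (hGT : ∀ n x, 0 ≤ x → G n x ≤ solidSeminorm T x)
    (hGy : ∀ i n, i < n → G i (y n) ≤ (1 / 2) ^ n) {ε : ℝ} (hε : 0 < ε) :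
    ¬ ∀ n, ε < G n (y n) := by
  intro hcon
  set V : ℕ → ℕ → E := fun j k => partialSups (fun i => y (j + i)) k with hV
  have hVy : ∀ j n, j ≤ n → y n ≤ V j (n - j) := fun j n hjn => by
    have := le_partialSups (fun i => y (j + i)) (n - j)
    simpa only [Nat.add_sub_cancel' hjn] using this
  have hVm : ∀ j, Monotone (V j) := fun j => (partialSups _).monotone
  have hV0 : ∀ j k, 0 ≤ V j k := fun j k =>
    (hy0 _).trans ((le_partialSups (fun i => y (j + i)) 0).trans (hVm j (Nat.zero_le k)))
  have hVu : ∀ j k, V j k ≤ u := fun j k => partialSups_le _ _ _ fun i _ => hyu _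
  choose m hm using fun j => exists_forall_solidSeminorm_sub_le hT (hVm j) (hV0 j) (hVu j)
    (show 0 < ε / 8 * (1 / 2) ^ j by positivity)
  set v : ℕ → E := fun j => V j (m j) with hv
  have hyv : ∀ j n, j ≤ n → solidSeminorm T (y n - v j)⁺ ≤ ε / 8 * (1 / 2) ^ j := by
    intro j n hjn
    refine le_trans ?_ (hm j (max (n - j) (m j)) (le_max_right _ _))
    refine solidSeminorm_mono_of_nonneg T (posPart_nonneg _) (sup_le ?_ ?_)
    · exact sub_le_sub_right ((hVy j n hjn).trans (hVm j (le_max_left _ _))) _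
    · exact sub_nonneg.2 (hVm j (le_max_right _ _))
  obtain ⟨s, hs0, hs⟩ : ∃ s : ℕ → E, s 0 = v 0 ∧ ∀ n, s (n + 1) = s n ⊓ v (n + 1) :=
    ⟨fun n => Nat.rec (v 0) (fun n x => x ⊓ v (n + 1)) n, rfl, fun _ => rfl⟩
  have hsa : Antitone s := antitone_nat_of_succ_le fun n => (hs n).trans_le inf_le_left
  have hsv : ∀ n, s n ≤ v n := by
    rintro (_ | n)
    · exact hs0.le
    · exact (hs n).trans_le inf_le_right
  have hsnn : ∀ n, 0 ≤ s n := by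
    intro n
    induction n with
    | zero => exact hs0 ▸ hV0 _ _
    | succ n ih => exact hs n ▸ le_inf ih (hV0 _ _)
  have hys : ∀ n k, k ≤ n → solidSeminorm T (y n - s k)⁺ ≤
      ∑ j ∈ Finset.range (k + 1), ε / 8 * (1 / 2) ^ j := by
    intro n k
    induction k with
    | zero => intro h; simpa [hs0] using hyv 0 n h
    | succ k ih =>
      intro h
      rw [Finset.sum_range_succ, hs]
      refine (solidSeminorm_le_add T (posPart_nonneg _) (posPart_nonneg _)
        ((abs_of_nonneg (posPart_nonneg _)).trans_le (posPart_sub_inf_le _ _ _))).trans ?_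
      exact add_le_add (ih (by omega)) (hyv _ _ h)
  have hsum : ∀ k, ∑ j ∈ Finset.range (k + 1), ε / 8 * (1 / 2 : ℝ) ^ j ≤ ε / 4 := by
    intro k
    rw [← Finset.mul_sum]
    have := sum_geometric_two_le (k + 1)
    nlinarith
  -- The Cauchy property is for increasing sequences, hence the passage to `u - s n`.
  obtain ⟨N, hN⟩ := exists_forall_solidSeminorm_sub_le hT (v := fun n => u - s n) (u := u)
    (fun _ _ h => sub_le_sub_left (hsa h) u)
    (fun n => sub_nonneg.2 ((hsv n).trans (hVu _ _))) (fun n => sub_le_self u (hsnn n))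
    (show 0 < ε / 4 by positivity)
  have key : ∀ n, N < n → ε / 2 ≤ (1 / 2) ^ n * 2 := by
    intro n hn
    have h₁ : G N (s N - s n) ≤ ε / 4 := by
      refine (hGT N _ (sub_nonneg.2 (hsa hn.le))).trans ?_
      have := hN n hn.le
      rwa [sub_sub_sub_cancel_left] at this
    have h₂ : G N (y N) ≤ G N (s N) + G N (y N - s N)⁺ := by
      rw [← map_add]
      exact functional_mono _ (hG N) (sub_le_iff_le_add'.1 (le_posPart _))
    have h₃ : G N (y N - s N)⁺ ≤ ε / 4 :=
      (hGT N _ (posPart_nonneg _)).trans ((hys N N le_rfl).trans (hsum N))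
    have h₄ : G N (s n) ≤ (1 / 2) ^ n * 2 :=
      (functional_mono _ (hG N) (hsv n)).trans
        (map_partialSups_le_of_geometric (hG N) hy0 (fun k hk => hGy N k (hn.trans_le hk)) _)
    rw [map_sub] at h₁
    linarith [hcon N]
  have hlim : Tendsto (fun n : ℕ => (1 / 2 : ℝ) ^ n * 2) atTop (𝓝 (0 * 2)) :=
    (tendsto_pow_atTop_nhds_zero_of_lt_one (by norm_num) (by norm_num)).mul_const 2
  have : ε / 2 ≤ 0 * 2 := ge_of_tendsto hlim ((eventually_gt_atTop N).mono key)
  linarith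

lemma pow_strictMono_le_pow {a : ℕ → ℕ} (ha : StrictMono a) {r : ℝ} (hr0 : 0 ≤ r) (hr1 : r ≤ 1)
    (n : ℕ) : r ^ a n ≤ r ^ n :=
  pow_le_pow_of_le_one hr0 hr1 (ha.id_le n)

/-- An operator that is null on order bounded disjoint sequences is null on weakly null families
of positive elements of an order interval. -/
lemma IsNullOnOrderBoundedDisjoint.tendsto_solidSeminorm (hT : IsNullOnOrderBoundedDisjoint T)
    {ι : Type*} {l : Filter ι} {u : E} {y : ι → E} (hy0 : ∀ i, 0 ≤ y i) (hyu : ∀ i, y i ≤ u)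
    (hy : ∀ f : E →L[ℝ] ℝ, Tendsto (fun i => f (y i)) l (𝓝 0)) :
    Tendsto (fun i => solidSeminorm T (y i)) l (𝓝 0) := by
  by_contra hcon
  obtain ⟨ε, hε, hbad⟩ : ∃ ε > 0, ∃ᶠ i in l, ε ≤ solidSeminorm T (y i) := by
    rw [Metric.tendsto_nhds] at hcon
    push Not at hcon
    simpa [dist_zero_right, abs_of_nonneg, solidSeminorm_nonneg] using hcon
  have hF : ∀ i, ∃ F : E →L[ℝ] ℝ, (∀ x, 0 ≤ x → 0 ≤ F x) ∧
      (∀ x, 0 ≤ x → F x ≤ solidSeminorm T x) ∧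
      (ε ≤ solidSeminorm T (y i) → ε / 2 < F (y i)) := by
    intro i
    by_cases h : ε ≤ solidSeminorm T (y i)
    · obtain ⟨f, hf, hfy⟩ := exists_lt_solidSeminorm_comp ((half_lt_self hε).trans_le h)
      obtain ⟨F, hFf⟩ := exists_modulus (f ∘L T)
      refine ⟨F, fun x hx => ?_, fun x hx => ?_, fun _ => ?_⟩
      · rw [hFf x hx]; exact solidSeminorm_nonneg _ _
      · rw [hFf x hx]; exact solidSeminorm_comp_le T hf x
      · rwa [hFf _ (hy0 i)]
    -- Indices that are not bad get the zero functional; they are never selected.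
    · exact ⟨0, fun _ _ => le_rfl, fun x _ => solidSeminorm_nonneg T x, fun h' => absurd h' h⟩
  choose F hF0 hFT hFy using hF
  -- `ι` carries no numbering, so each chosen index is paired with a strictly increasing counter
  -- that fixes the rate.
  obtain ⟨p, hp, hpp⟩ := exists_seq_of_forall_finset_exists
    (fun p : ℕ × ι => ε ≤ solidSeminorm T (y p.2))
    (fun p q => p.1 < q.1 ∧ F p.2 (y q.2) ≤ (1 / 2) ^ q.1) (by
      intro t _
      set n := t.sup Prod.fst + 1 with hn
      have hev : ∀ᶠ i in l, ∀ q ∈ t, F q.2 (y i) < (1 / 2) ^ n :=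
        t.eventually_all.2 fun q _ =>
          (hy (F q.2)).eventually_lt_const (by positivity)
      obtain ⟨i, hi, hi'⟩ := (hbad.and_eventually hev).exists
      exact ⟨(n, i), hi, fun q hq =>
        ⟨Nat.lt_succ_of_le (Finset.le_sup (f := Prod.fst) hq), (hi' q hq).le⟩⟩)
  have hmono : StrictMono fun n => (p n).1 := fun m n hmn => (hpp m n hmn).1
  exact not_forall_lt_of_geometric hT (fun n => hy0 (p n).2) (fun n => hyu (p n).2)
    (fun n => hF0 (p n).2) (fun n => hFT (p n).2)
    (fun i n hin => (hpp i n hin).2.trans (pow_strictMono_le_pow hmono (by norm_num) (by norm_num) n))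
    (half_pos hε) fun n => hFy _ (hp n)

end OrderBounded

/-! ### Uaw-null families -/

section UnboundedNull

variable {E : Type*} [NormedAddCommGroup E] [NormedSpace ℝ E] [Lattice E]
  [IsOrderedAddMonoid E] [IsOrderedModule ℝ E] [HasSolidNorm E]
  {Y : Type*} [NormedAddCommGroup Y] [NormedSpace ℝ Y] {T : E →L[ℝ] Y}

lemma inf_sum_le_sum_inf {G ι : Type*} [AddCommGroup G] [Lattice G] [IsOrderedAddMonoid G]
    {a : ι → G} {c : G} (ha : ∀ i, 0 ≤ a i) (hc : 0 ≤ c) (s : Finset ι) :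
    c ⊓ ∑ i ∈ s, a i ≤ ∑ i ∈ s, c ⊓ a i := by
  classical
  induction s using Finset.induction_on with
  | empty => simp
  | insert k s hk ih =>
    rw [Finset.sum_insert hk, Finset.sum_insert hk, inf_comm, inf_comm c (a k)]
    refine (add_inf_le_inf_add_inf (ha k) (Finset.sum_nonneg fun i _ => ha i) hc).trans ?_
    rw [inf_comm (∑ i ∈ s, a i) c]
    exact add_le_add_right ih _

/-- If the terms of a bounded sequence are almost disjoint with respect to `solidSeminorm T`,
then it is a disjoint sequence up to terms that are negligible for `solidSeminorm T`. -/
lemma tendsto_solidSeminorm_of_almost_disjoint [CompleteSpace E] {x : ℕ → E} {C : ℝ}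
    (hx : ∀ n, ‖x n‖ ≤ C)
    (hT : ∀ z : ℕ → E, IsDisjointSeq z → (∀ n, |z n| ≤ |x n|) →
      Tendsto (fun n => T (z n)) atTop (𝓝 0))
    (hxx : ∀ m n, m < n → solidSeminorm T (|x n| ⊓ (4 : ℝ) ^ n • |x m|) ≤ (1 / 4) ^ n) :
    Tendsto (fun n => solidSeminorm T (x n)) atTop (𝓝 0) := by
  have hsX : Summable fun n => (1 / 2 : ℝ) ^ n • |x n| := by
    refine Summable.of_norm_bounded (summable_geometric_two.mul_right C) fun n => ?_
    rw [norm_smul, norm_abs_eq_norm, Real.norm_of_nonneg (by positivity)]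
    exact mul_le_mul_of_nonneg_left (hx n) (by positivity)
  have hX1 : ∀ n, 0 ≤ (1 / 2 : ℝ) ^ n • |x n| := fun n => smul_nonneg (by positivity) (abs_nonneg _)
  set X : E := ∑' n, (1 / 2 : ℝ) ^ n • |x n| with hX
  have hxX : ∀ n, (1 / 2 : ℝ) ^ n • |x n| ≤ X := fun n => hsX.le_tsum n fun m _ => hX1 m
  have hX0 : 0 ≤ X := (hX1 0).trans (hxX 0)
  set A : ℕ → E := fun n => ∑ m ∈ Finset.range n, (4 : ℝ) ^ n • |x m| with hA
  have hterm : ∀ n m : ℕ, 0 ≤ (4 : ℝ) ^ n • |x m| := fun n m =>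
    smul_nonneg (by positivity) (abs_nonneg _)
  have hA0 : ∀ n, 0 ≤ A n := fun n => Finset.sum_nonneg fun m _ => hterm n m
  have hB0 : ∀ n : ℕ, 0 ≤ (1 / 2 : ℝ) ^ n • X := fun n => smul_nonneg (by positivity) hX0
  -- Subtracting `A n` separates `x n` from earlier terms; subtracting `2⁻ⁿ X` separates it from
  -- later ones, because `4⁻ⁿ |x n| ≤ 2⁻ⁿ X ≤ 2⁻ᵐ X` for `m < n`.
  set w : ℕ → E := fun n => (|x n| - (A n + (1 / 2 : ℝ) ^ n • X))⁺ with hw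
  have hw0 : ∀ n, 0 ≤ w n := fun n => posPart_nonneg _
  have hwx : ∀ n, w n ≤ |x n| := fun n =>
    sup_le (sub_le_self _ (add_nonneg (hA0 n) (hB0 n))) (abs_nonneg _)
  have hlt : ∀ m n, m < n → w n ⊓ w m = 0 := by
    intro m n hmn
    refine inf_eq_zero_of_smul_le (a := |x n|) (b := |x m|) (C := 4 ^ n)
      (one_le_pow₀ (by norm_num)) (hw0 n) (hw0 m) (posPart_mono (sub_le_sub_left ?_ _))
      (posPart_mono (sub_le_sub_left ?_ _))
    · exact (Finset.single_le_sum (f := fun m => (4 : ℝ) ^ n • |x m|) (fun m _ => hterm n m)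
        (Finset.mem_range.2 hmn)).trans (le_add_of_nonneg_right (hB0 n))
    · refine le_trans ?_ (le_add_of_nonneg_left (hA0 m))
      calc ((4 : ℝ) ^ n)⁻¹ • |x n| = (1 / 2 : ℝ) ^ n • (1 / 2 : ℝ) ^ n • |x n| := by
            rw [smul_smul, ← mul_pow, ← inv_pow]; norm_num
        _ ≤ (1 / 2 : ℝ) ^ n • X := smul_le_smul_of_nonneg_left (hxX n) (by positivity)
        _ ≤ (1 / 2 : ℝ) ^ m • X := smul_le_smul_of_nonneg_right
            (pow_le_pow_of_le_one (by norm_num) (by norm_num) hmn.le) hX0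
  have hwlim : Tendsto (fun n => solidSeminorm T (w n)) atTop (𝓝 0) := by
    refine tendsto_solidSeminorm_of_isDisjointSeq (fun m n hmn => ?_) fun z hz hzw =>
      hT z hz fun n => (hzw n).trans ((abs_of_nonneg (hw0 n)).trans_le (hwx n))
    rw [abs_of_nonneg (hw0 m), abs_of_nonneg (hw0 n)]
    rcases lt_or_gt_of_ne hmn with h | h
    · rw [inf_comm]; exact hlt m n h
    · exact hlt n m h
  have hAlim : ∀ n, solidSeminorm T (|x n| ⊓ A n) ≤ n * (1 / 4 : ℝ) ^ n := by
    intro n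
    refine (solidSeminorm_mono_of_nonneg T (le_inf (abs_nonneg _) (hA0 n))
      (inf_sum_le_sum_inf (hterm n) (abs_nonneg _) _)).trans
      ((solidSeminorm_sum_le T _ fun m => le_inf (abs_nonneg _) (hterm n m)).trans ?_)
    refine (Finset.sum_le_sum fun m hm => hxx m n (Finset.mem_range.1 hm)).trans_eq ?_
    simp
  have hbound : ∀ n, solidSeminorm T (x n) ≤
      n * (1 / 4 : ℝ) ^ n + ‖T‖ * ((1 / 2 : ℝ) ^ n * ‖X‖) + solidSeminorm T (w n) := by
    intro n
    have hi : 0 ≤ |x n| ⊓ A n := le_inf (abs_nonneg _) (hA0 n)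
    have h₁ : solidSeminorm T (x n) ≤
        solidSeminorm T (|x n| ⊓ A n + (1 / 2 : ℝ) ^ n • X) + solidSeminorm T (w n) := by
      refine solidSeminorm_le_add T (add_nonneg hi (hB0 n)) (hw0 n) ?_
      refine (le_inf_add_posPart_sub |x n| (A n + (1 / 2 : ℝ) ^ n • X)).trans
        (add_le_add_left ?_ _)
      rw [inf_comm, inf_comm |x n|]
      exact (add_inf_le_inf_add_inf (hA0 n) (hB0 n) (abs_nonneg _)).trans
        (add_le_add_right inf_le_left _)
    have h₂ : solidSeminorm T (|x n| ⊓ A n + (1 / 2 : ℝ) ^ n • X) ≤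
        solidSeminorm T (|x n| ⊓ A n) + solidSeminorm T ((1 / 2 : ℝ) ^ n • X) :=
      solidSeminorm_le_add T hi (hB0 n) (abs_of_nonneg (add_nonneg hi (hB0 n))).le
    have h₃ := solidSeminorm_le_opNorm T ((1 / 2 : ℝ) ^ n • X)
    rw [norm_smul, Real.norm_of_nonneg (by positivity)] at h₃
    linarith [hAlim n]
  refine squeeze_zero (fun n => solidSeminorm_nonneg T _) hbound ?_
  have h₁ := tendsto_self_mul_const_pow_of_lt_one (r := (1 / 4 : ℝ)) (by norm_num) (by norm_num)
  have h₂ := ((tendsto_pow_atTop_nhds_zero_of_lt_one (r := (1 / 2 : ℝ)) (by norm_num)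
    (by norm_num)).mul_const ‖X‖).const_mul ‖T‖
  simpa using (h₁.add h₂).add hwlim

omit [IsOrderedAddMonoid E] [IsOrderedModule ℝ E] [HasSolidNorm E] in
lemma uawTendsto_zero_iff {ι : Type*} {l : Filter ι} {x : ι → E} :
    UAWTendsto x l 0 ↔ ∀ u, 0 ≤ u → ∀ f : E →L[ℝ] ℝ,
      Tendsto (fun i => f (|x i| ⊓ u)) l (𝓝 0) := by
  refine forall₂_congr fun u _ => ?_
  rw [tendsto_toWeakSpace_iff]
  simp only [sub_zero, map_zero]

lemma abs_inf_le_abs {G : Type*} [AddCommGroup G] [Lattice G] [IsOrderedAddMonoid G] {x u : G}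
    (hu : 0 ≤ u) : |(|x| ⊓ u)| ≤ |x| :=
  (abs_of_nonneg (le_inf (abs_nonneg x) hu)).trans_le inf_le_left

/-- A uaw-null family in a norm bounded solid set `A` is mapped to a norm null family if `T` is
null on order bounded disjoint sequences and on disjoint sequences of `A`. -/
lemma IsNullOnOrderBoundedDisjoint.tendsto_of_uawTendsto [CompleteSpace E]
    (hT : IsNullOnOrderBoundedDisjoint T) {S : Set E} {C : ℝ} (hS : ∀ x ∈ S, ‖x‖ ≤ C)
    (hTS : ∀ z : ℕ → E, IsDisjointSeq z → (∀ n, z n ∈ sol S) →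
      Tendsto (fun n => T (z n)) atTop (𝓝 0))
    {ι : Type*} {l : Filter ι} {x : ι → E} (hxS : ∀ i, x i ∈ sol S) (hx : UAWTendsto x l 0) :
    Tendsto (fun i => T (x i)) l (𝓝 0) := by
  have hxu : ∀ u, 0 ≤ u → Tendsto (fun i => solidSeminorm T (|x i| ⊓ u)) l (𝓝 0) := fun u hu =>
    hT.tendsto_solidSeminorm (fun i => le_inf (abs_nonneg _) hu) (fun _ => inf_le_right)
      (uawTendsto_zero_iff.1 hx u hu)
  suffices h : Tendsto (fun i => solidSeminorm T (x i)) l (𝓝 0) from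
    squeeze_zero_norm (fun i => norm_le_solidSeminorm T le_rfl) h
  by_contra hcon
  obtain ⟨ε, hε, hbad⟩ : ∃ ε > 0, ∃ᶠ i in l, ε ≤ solidSeminorm T (x i) := by
    rw [Metric.tendsto_nhds] at hcon
    push Not at hcon
    simpa [dist_zero_right, abs_of_nonneg, solidSeminorm_nonneg] using hcon
  have hterm : ∀ (n : ℕ) i, 0 ≤ (4 : ℝ) ^ n • |x i| := fun n i =>
    smul_nonneg (by positivity) (abs_nonneg _)
  obtain ⟨p, hp, hpp⟩ := exists_seq_of_forall_finset_exists
    (fun p : ℕ × ι => ε ≤ solidSeminorm T (x p.2))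
    (fun p q => p.1 < q.1 ∧
      solidSeminorm T (|x q.2| ⊓ (4 : ℝ) ^ q.1 • |x p.2|) ≤ (1 / 4) ^ q.1) (by
      intro t _
      set n := t.sup Prod.fst + 1 with hn
      have hev : ∀ᶠ i in l, ∀ q ∈ t,
          solidSeminorm T (|x i| ⊓ (4 : ℝ) ^ n • |x q.2|) < (1 / 4) ^ n :=
        t.eventually_all.2 fun q _ =>
          (hxu _ (hterm n q.2)).eventually_lt_const (by positivity)
      obtain ⟨i, hi, hi'⟩ := (hbad.and_eventually hev).exists
      exact ⟨(n, i), hi, fun q hq =>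
        ⟨Nat.lt_succ_of_le (Finset.le_sup (f := Prod.fst) hq), (hi' q hq).le⟩⟩)
  have hmono : StrictMono fun n => (p n).1 := fun m n hmn => (hpp m n hmn).1
  have hlim := tendsto_solidSeminorm_of_almost_disjoint (T := T) (x := fun n => x (p n).2) (C := C)
    (fun n => by
      obtain ⟨y, hy, hxy⟩ := hxS (p n).2
      exact (norm_le_norm_of_abs_le_abs hxy).trans (hS y hy))
    (fun z hz hzx => hTS z hz fun n => by
      obtain ⟨y, hy, hxy⟩ := hxS (p n).2
      exact ⟨y, hy, (hzx n).trans hxy⟩)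
    (fun m n hmn => by
      -- The counters dominate the positions, so `4 ^ n` and `(1 / 4) ^ n` may replace the powers by
      -- the counter.
      refine le_trans (solidSeminorm_mono_of_nonneg T (le_inf (abs_nonneg _) (hterm n _))
        (inf_le_inf_left _ ?_)) ((hpp m n hmn).2.trans
          (pow_strictMono_le_pow hmono (by norm_num) (by norm_num) n))
      exact smul_le_smul_of_nonneg_right
        (pow_le_pow_right₀ (by norm_num) (hmono.id_le n)) (abs_nonneg _))
  have : ε ≤ 0 := ge_of_tendsto' hlim hp
  linarith

lemma IsAlmostDunfordPettis.tendsto_of_isDisjointSeq (hT : IsAlmostDunfordPettis T) {S : Set E}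
    (hS : IsRelativelyWeaklyCompact S) {z : ℕ → E} (hz : IsDisjointSeq z)
    (hzS : ∀ n, z n ∈ sol S) : Tendsto (fun n => T (z n)) atTop (𝓝 0) :=
  hT z hz <| tendsto_toWeakSpace_iff.2 fun f => by
    simpa using hS.tendsto_of_isDisjointSeq hz hzS f

/-- An order interval lies in the solid hull of a single point, which is weakly compact. -/
lemma IsAlmostDunfordPettis.isNullOnOrderBoundedDisjoint (hT : IsAlmostDunfordPettis T) :
    IsNullOnOrderBoundedDisjoint T := fun u _ hz hzu =>
  hT.tendsto_of_isDisjointSeq (isRelativelyWeaklyCompact_singleton u) hz fun n =>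
    ⟨u, rfl, (hzu n).trans (le_abs_self u)⟩

/-- Disjoint sequences are uaw-null. -/
lemma IsDisjointSeq.uawTendsto {x : ℕ → E} (hx : IsDisjointSeq x) : UAWTendsto x atTop 0 := by
  refine uawTendsto_zero_iff.2 fun u hu f => ?_
  have h0 : ∀ n, 0 ≤ |x n| ⊓ u := fun n => le_inf (abs_nonneg _) hu
  refine (isRelativelyWeaklyCompact_singleton u).tendsto_of_isDisjointSeq (fun m n hmn => ?_)
    (fun n => ⟨u, rfl, ?_⟩) f
  · exact inf_eq_zero_of_le (abs_nonneg _) (abs_nonneg _) (abs_inf_le_abs hu) (abs_inf_le_abs hu)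
      (hx m n hmn)
  · rw [abs_of_nonneg (h0 n)]
    exact inf_le_right.trans (le_abs_self u)

end UnboundedNull
end BanachLatticeOps

/-! ### The equivalences -/

theorem proposition3p17
    {E : Type u} [NormedAddCommGroup E] [NormedSpace ℝ E] [CompleteSpace E]
    [Lattice E] [IsOrderedAddMonoid E] [IsOrderedModule ℝ E] [HasSolidNorm E]
    {Y : Type v} [NormedAddCommGroup Y] [NormedSpace ℝ Y] [CompleteSpace Y]
    (T : E →L[ℝ] Y) :
    List.TFAE [
      IsAlmostDunfordPettis T,
      ∀ S : Set E, IsRelativelyWeaklyCompact S → IsLWeaklyCompactOn S T,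
      ∀ S : Set E, IsRelativelyWeaklyCompact S →
        ∀ (ι : Type w) [Preorder ι] [IsDirectedOrder ι] [Nonempty ι] (x : ι → E),
          (∀ i, x i ∈ sol S) → UAWTendsto x atTop 0 →
            Tendsto (fun i => T (x i)) atTop (𝓝 0),
      ∀ S : Set E, IsRelativelyWeaklyCompact S →
        ∀ x : ℕ → E, (∀ n, x n ∈ sol S) → UAWTendsto x atTop 0 →
          Tendsto (fun n => T (x n)) atTop (𝓝 0)] := by
  tfae_have 1 → 3 := by
    intro hT S hS ι _ _ _ x hxS hx
    obtain ⟨C, hC⟩ := hS.exists_norm_le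
    exact hT.isNullOnOrderBoundedDisjoint.tendsto_of_uawTendsto hC
      (fun z hz hzS => hT.tendsto_of_isDisjointSeq hS hz hzS) hxS hx
  tfae_have 3 → 4 := by
    intro h S hS x hxS hx
    -- Nets are indexed in `Type w`, so a sequence enters as a net over `ULift ℕ`.
    have hdown : Tendsto (ULift.down : ULift.{w} ℕ → ℕ) atTop atTop :=
      tendsto_atTop_atTop.2 fun b => ⟨⟨b⟩, fun _ h => h⟩
    have hup : Tendsto (ULift.up : ℕ → ULift.{w} ℕ) atTop atTop :=
      tendsto_atTop_atTop.2 fun b => ⟨b.down, fun _ h => h⟩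
    have : IsDirectedOrder (ULift.{w} ℕ) :=
      ⟨fun a b => ⟨⟨max a.down b.down⟩, le_max_left a.down b.down, le_max_right a.down b.down⟩⟩
    exact (h S hS (ULift.{w} ℕ) (fun i => x i.down) (fun i => hxS i.down)
      fun u hu => (hx u hu).comp hdown).comp hup
  tfae_have 4 → 2 := fun h => h
  tfae_have 2 → 1 := by
    intro h x hx hx0
    exact h _ (isRelativelyWeaklyCompact_range_of_tendsto hx0) x
      (fun n => ⟨x n, ⟨n, rfl⟩, le_rfl⟩) hx.uawTendsto
  tfae_finish
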